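/- Let $\mathcal X,\mathcal Y$ be finite alphabets and let $(X,Y)=\{(X_n,Y_n):n\ge 1\}$ be a jointly stationary and ergodic process with values in $\mathcal X\times\mathcal Y$. Write $Z_1^n=(Z_1,\dots,Z_n)$, and let $$H(X|Y)=\limsup_{n\to\infty}\frac1n H(X_1^n|Y_1^n)$$ be the conditional entropy rate, where $H(\cdot|\cdot)$ is the discrete conditional entropy in bits (logarithms to base 2). A compressor with side information of blocklength $n$ is a function $f_n(x_1^n|y_1^n)$ of $x_1^n\in\mathcal X^n$, $y_1^n\in\mathcal Y^n$ with values in the set $\{0,1\}^*$ of all finite binary strings (including the empty one) such that $f_n(\cdot|y_1^n)$ is one-to-one on $\mathcal X^n$ for each $y_1^n$; $\ell(s)$ denotes the length of a string $s$. An optimal compressor $f_n^*$ is one that, for each $y_1^n$, orders the strings $x_1^n$ by decreasing conditional probability $\mathbb P(X_1^n=x_1^n|Y_1^n=y_1^n)$ (ties broken arbitrarily, and in any order if $\mathbb P(Y_1^n=y_1^n)=0$) and assigns to them, in this order, the binary strings $\emptyset,0,1,00,01,10,11,000,\dots$ (ordered by length and then lexicographically). Then: (a) For any sequence of compressors with side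 information $\{f_n\}$, $$\liminf_{n\to\infty}\frac{\ell(f_n(X_1^n|Y_1^n))}{n}\ \ge\ H(X|Y)\qquad\text{almost surely.}$$ (b) The optimal compressors $\{f_n^*\}$ achieve this bound with equality: almost surely, $$\liminf_{n\to\infty}\frac{\ell(f_n^*(X_1^n|Y_1^n))}{n}=H(X|Y),$$ and the liminf is in fact a limit. -/

import Mathlib

open MeasureTheory ProbabilityTheory Filter Topology

/-- The left shift `(z₁, z₂, z₃, …) ↦ (z₂, z₃, …)` on one-sided sequences. -/
def seqShift {Z : Type*} (z : ℕ → Z) : ℕ → Z := fun i => z (i + 1)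

/-- A source-side information pair on the probability space `(Ω, μ)`, with alphabets `𝒳`, `𝒴`.
The time index `n ≥ 1` is shifted: `X i` is the `(i+1)`-st source symbol `X_{i+1}`,
and similarly for `Y`. The pair is jointly stationary and ergodic if the joint process
`((X_i, Y_i))_i` is: its law on sequence space is invariant and ergodic under the shift. -/
structure IsStationaryErgodicPair {Ω 𝒳 𝒴 : Type*} [MeasurableSpace Ω]
    [MeasurableSpace 𝒳] [MeasurableSpace 𝒴] (μ : Measure Ω)
    (X : ℕ → Ω → 𝒳) (Y : ℕ → Ω → 𝒴) : Prop where
  measurable_source : ∀ i, Measurable (X i)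
  measurable_side : ∀ i, Measurable (Y i)
  stationary : MeasurePreserving seqShift
    (μ.map fun ω i => (X i ω, Y i ω)) (μ.map fun ω i => (X i ω, Y i ω))
  ergodic : Ergodic seqShift (μ.map fun ω i => (X i ω, Y i ω))

/-- The block `Z_1^n = (Z_1, …, Z_n)` of a process (with `Z i` standing for `Z_{i+1}`). -/
def block {Ω Z : Type*} (W : ℕ → Ω → Z) (n : ℕ) (ω : Ω) : Fin n → Z := fun i => W i ω

/-- The conditional probability `ℙ(V = v | W = w)`. -/
noncomputable def condPmf {Ω S T : Type*} [MeasurableSpace Ω] (μ : Measure Ω)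
    (V : Ω → S) (W : Ω → T) (v : S) (w : T) : ℝ :=
  (μ[|W ⁻¹' {w}]).real (V ⁻¹' {v})

/-- The discrete conditional entropy `H(V | W)`, in bits:
`∑_w ℙ(W = w) ∑_v - ℙ(V = v | W = w) log₂ ℙ(V = v | W = w)`. -/
noncomputable def condEntropy {Ω S T : Type*} [MeasurableSpace Ω] [Fintype S] [Fintype T]
    (μ : Measure Ω) (V : Ω → S) (W : Ω → T) : ℝ :=
  ∑ w, μ.real (W ⁻¹' {w}) *
    ∑ v, -(condPmf μ V W v w * Real.logb 2 (condPmf μ V W v w))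

/-- The conditional entropy rate `limsup_n H(X_1^n | Y_1^n) / n`, in bits per symbol. The
sequence takes values in `[0, log₂ |𝒳|]`, so this is a genuine real `limsup`. -/
noncomputable def condEntropyRate {Ω 𝒳 𝒴 : Type*} [MeasurableSpace Ω] [Fintype 𝒳] [Fintype 𝒴]
    (μ : Measure Ω) (X : ℕ → Ω → 𝒳) (Y : ℕ → Ω → 𝒴) : ℝ :=
  limsup (fun n : ℕ => condEntropy μ (block X n) (block Y n) / n) atTop

/-- A fixed-to-variable one-to-one compressor with side information, of blocklength `n`:
`encode x y` is the finite binary string `f_n(x_1^n | y_1^n)`, and for each side information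
string `y` the map `f_n(· | y)` is injective. -/
structure SideInfoCompressor (𝒳 𝒴 : Type*) (n : ℕ) where
  encode : (Fin n → 𝒳) → (Fin n → 𝒴) → List Bool
  injective : ∀ y, Function.Injective fun x => encode x y

/-- The `k`-th finite binary string (`k = 0, 1, 2, …`) in the lexicographic order
`∅, 0, 1, 00, 01, 10, 11, 000, …` (by length, then lexicographically within a length): it is
the binary expansion of `k + 1`, most significant digit first, with the leading `1` removed. -/
def binString (k : ℕ) : List Bool := (Nat.bits (k + 1)).reverse.tail

/-- `f` is an optimal compressor of blocklength `n` for the pair `(X, Y)`: for each side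
information string `y`, the source strings are ranked (ranks `0, 1, …, |𝒳|ⁿ - 1`) in order of
decreasing probability `ℙ(X_1^n = x | Y_1^n = y)`, and the string of rank `k` is assigned the
`k`-th codeword in lexicographic order. Ties may be broken in any way; if `ℙ(Y_1^n = y) = 0`, the
conditional distribution is undefined and the ranking for that `y` may be any ranking. -/
def IsOptimalCompressor {Ω 𝒳 𝒴 : Type*} [MeasurableSpace Ω] [Fintype 𝒳]
    (μ : Measure Ω) (X : ℕ → Ω → 𝒳) (Y : ℕ → Ω → 𝒴) (n : ℕ)
    (f : SideInfoCompressor 𝒳 𝒴 n) : Prop :=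
  ∀ y : Fin n → 𝒴, ∃ rank : (Fin n → 𝒳) ≃ Fin (Fintype.card (Fin n → 𝒳)),
    (∀ x x', rank x ≤ rank x' →
      condPmf μ (block X n) (block Y n) x' y ≤ condPmf μ (block X n) (block Y n) x y) ∧
    ∀ x, f.encode x y = binString (rank x)

theorem binString_injective : Function.Injective binString := by
  have key : ∀ n : ℕ, n ≠ 0 → ∃ l, n.bits = l ++ [true] := by
    intro n
    induction n using Nat.binaryRec' with
    | zero => simp
    | bit b n h ih =>
      intro _
      rw [Nat.bits_append_bit n b h]
      by_cases hn : n = 0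
      · exact ⟨[], by simp [hn, h hn]⟩
      · obtain ⟨l, hl⟩ := ih hn
        exact ⟨b :: l, by simp [hl]⟩
  have inj : Function.Injective Nat.bits := by
    intro a
    induction a using Nat.binaryRec' with
    | zero =>
      intro b hb
      by_contra h
      obtain ⟨l, hl⟩ := key b (fun h' => h h'.symm)
      simp [hl] at hb
    | bit b n h ih =>
      intro m hm
      rw [Nat.bits_append_bit n b h] at hm
      induction m using Nat.binaryRec' with
      | zero => simp at hm
      | bit b' m h' _ =>
        rw [Nat.bits_append_bit m b' h'] at hm
        obtain ⟨h1, h2⟩ := List.cons.inj hm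
        rw [h1, ih h2]
  intro a b hab
  obtain ⟨l, hl⟩ := key (a + 1) (by omega)
  obtain ⟨m, hm⟩ := key (b + 1) (by omega)
  have : l = m := by simpa [binString, hl, hm] using hab
  have := inj (hl.trans (this ▸ hm.symm))
  omega

/-- Optimal compressors exist. -/
theorem exists_isOptimalCompressor {Ω 𝒳 𝒴 : Type*} [MeasurableSpace Ω] [Fintype 𝒳]
    (μ : Measure Ω) (X : ℕ → Ω → 𝒳) (Y : ℕ → Ω → 𝒴) (n : ℕ) :
    ∃ f : SideInfoCompressor 𝒳 𝒴 n, IsOptimalCompressor μ X Y n f := by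
  let e := Fintype.equivFin (Fin n → 𝒳)
  let g : (Fin n → 𝒴) → Fin (Fintype.card (Fin n → 𝒳)) → ℝ := fun y i =>
    -condPmf μ (block X n) (block Y n) (e.symm i) y
  let r := fun y => e.trans (Tuple.sort (g y)).symm
  refine ⟨⟨fun x y => binString (r y x), fun y x x' h => ?_⟩, fun y => ⟨r y, ?_, fun x => rfl⟩⟩
  · exact (r y).injective (Fin.ext (binString_injective h))
  · intro x x' h
    have := Tuple.monotone_sort (g y) h
    simpa [r, g] using this

/-! Both parts compare the code length with the conditional information `-log₂ ℙ(X_1^n | Y_1^n)`,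
which almost surely grows like `n * condEntropyRate`. It is the information of the pair block minus
that of the side block, so this growth follows from Shannon–McMillan–Breiman, applied to the pair
process and to its second coordinate. The means converge along with the paths, which identifies the
limit as the entropy rate.

Shannon–McMillan–Breiman rests on writing the information of a block as a sum of `infoIncrement`s.
These are logarithms of conditional probabilities which converge as martingales and have an
integrable supremum, so Maker's extension of Birkhoff's theorem averages them.

For the lower bound, an injective code has at most `2 * 2 ^ r` codewords of length at most `r`.
Hence values of conditional probability at most `q` receive such codewords with probability at most
`2 * 2 ^ r * q`, and Borel–Cantelli applies. For the upper bound, the value of rank `k` (from 0) has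
probability at most `1 / (k + 1)`, and its codeword has length at most `log₂ (k + 1)`. -/

/-! ### Pointwise ergodic theorems of Birkhoff and Maker -/

section Birkhoff

variable {α : Type*} {T : α → α} {f : α → ℝ}

/-- The running maximum `max_{1 ≤ k ≤ n + 1} birkhoffSum T f k`, defined by its recursion. -/
def maxBirkhoffSum (T : α → α) (f : α → ℝ) : ℕ → α → ℝ
  | 0, x => f x
  | n + 1, x => f x + max 0 (maxBirkhoffSum T f n (T x))

theorem maxBirkhoffSum_le_succ (n : ℕ) (x : α) :
    maxBirkhoffSum T f n x ≤ maxBirkhoffSum T f (n + 1) x := by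
  induction n generalizing x with
  | zero => simp [maxBirkhoffSum]
  | succ n ih =>
    rw [maxBirkhoffSum, maxBirkhoffSum]
    gcongr
    exact ih _

theorem monotone_maxBirkhoffSum (x : α) : Monotone fun n => maxBirkhoffSum T f n x :=
  monotone_nat_of_le_succ fun n => maxBirkhoffSum_le_succ n x

theorem birkhoffSum_succ_le_maxBirkhoffSum (n : ℕ) (x : α) :
    birkhoffSum T f (n + 1) x ≤ maxBirkhoffSum T f n x := by
  induction n generalizing x with
  | zero => simp [maxBirkhoffSum]
  | succ n ih =>
    rw [birkhoffSum_succ', maxBirkhoffSum]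
    gcongr
    exact (ih _).trans (le_max_right _ _)

/-- Makes the boundedness set invariant under `T`, so that ergodicity gives it measure zero or full
measure. -/
theorem bddAbove_maxBirkhoffSum_comp (x : α) :
    BddAbove (Set.range fun n => maxBirkhoffSum T f n (T x)) ↔
      BddAbove (Set.range fun n => maxBirkhoffSum T f n x) := by
  constructor
  · rintro ⟨C, hC⟩
    refine ⟨f x + max 0 C, ?_⟩
    rintro _ ⟨n, rfl⟩
    refine (maxBirkhoffSum_le_succ n x).trans ?_
    rw [maxBirkhoffSum]
    gcongr
    exact hC ⟨n, rfl⟩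
  · rintro ⟨C, hC⟩
    refine ⟨C - f x, ?_⟩
    rintro _ ⟨n, rfl⟩
    have h : maxBirkhoffSum T f (n + 1) x ≤ C := hC ⟨n + 1, rfl⟩
    rw [maxBirkhoffSum] at h
    have := le_max_right 0 (maxBirkhoffSum T f n (T x))
    linarith

variable [MeasurableSpace α] {μ : Measure α}

theorem measurable_maxBirkhoffSum (hT : Measurable T) (hf : Measurable f) (n : ℕ) :
    Measurable (maxBirkhoffSum T f n) := by
  induction n with
  | zero => exact hf
  | succ n ih => exact hf.add (measurable_const.max (ih.comp hT))

theorem integrable_maxBirkhoffSum (hT : MeasurePreserving T μ μ) (hf : Integrable f μ) (n : ℕ) :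
    Integrable (maxBirkhoffSum T f n) μ := by
  induction n with
  | zero => exact hf
  | succ n ih =>
    have := (hT.integrable_comp_of_integrable ih).pos_part
    refine (hf.add this).congr (Eventually.of_forall fun x => ?_)
    simp [maxBirkhoffSum, max_comm]

theorem MeasureTheory.MeasurePreserving.integral_comp_eq {β : Type*} [MeasurableSpace β]
    {ν : Measure β} {S : α → β} (hS : MeasurePreserving S μ ν) {g : β → ℝ}
    (hg : AEStronglyMeasurable g ν) : ∫ x, g (S x) ∂μ = ∫ y, g y ∂ν := by
  rw [← hS.map_eq] at hg ⊢
  exact (integral_map hS.measurable.aemeasurable hg).symm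

/-- A form of the maximal ergodic theorem. With `M n` the running maximum, `M (n+1) - M n ∘ T = f +
max 0 (-M n ∘ T)`. Invariance makes the integral of the left side nonnegative, and the last term
tends to 0 where `M n ∘ T` diverges. -/
theorem integral_nonneg_of_ae_not_bddAbove_maxBirkhoffSum (hT : MeasurePreserving T μ μ)
    (hf : Integrable f μ)
    (h : ∀ᵐ x ∂μ, ¬ BddAbove (Set.range fun n => maxBirkhoffSum T f n x)) :
    0 ≤ ∫ x, f x ∂μ := by
  have hM := integrable_maxBirkhoffSum hT hf
  have hMT n : Integrable (fun x => maxBirkhoffSum T f n (T x)) μ :=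
    hT.integrable_comp_of_integrable (hM n)
  have hlim : Tendsto (fun n => ∫ x, (f x + max 0 (-maxBirkhoffSum T f n (T x))) ∂μ) atTop
      (𝓝 (∫ x, f x ∂μ)) := by
    refine tendsto_integral_of_dominated_convergence
      (fun x => |f x| + |maxBirkhoffSum T f 0 (T x)|) (fun n => ?_) (hf.abs.add (hMT 0).abs)
      (fun n => ?_) ?_
    · exact (hf.1.add ((aestronglyMeasurable_const (b := (0 : ℝ))).sup (hMT n).neg.1))
    · refine Eventually.of_forall fun x => ?_
      rw [Real.norm_eq_abs]
      refine (abs_add_le _ _).trans (add_le_add le_rfl ?_)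
      rw [abs_of_nonneg (le_max_left _ _)]
      refine max_le (abs_nonneg _) ((neg_le_neg ?_).trans (neg_le_abs _))
      exact monotone_maxBirkhoffSum (T x) (Nat.zero_le n)
    · filter_upwards [h] with x hx
      rw [← bddAbove_maxBirkhoffSum_comp] at hx
      have hmono := monotone_maxBirkhoffSum (T := T) (f := f) (T x)
      have htop := tendsto_atTop_atTop_of_monotone' hmono hx
      refine tendsto_const_nhds.congr' ?_
      filter_upwards [htop.eventually_ge_atTop 0] with n hn
      rw [max_eq_left (by linarith), add_zero]
  refine ge_of_tendsto' hlim fun n => ?_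
  have h1 : ∫ x, (f x + max 0 (-maxBirkhoffSum T f n (T x))) ∂μ
      = ∫ x, (maxBirkhoffSum T f (n + 1) x - maxBirkhoffSum T f n (T x)) ∂μ := by
    congr 1 with x
    rw [maxBirkhoffSum]
    rcases le_total 0 (maxBirkhoffSum T f n (T x)) with h | h
    · rw [max_eq_left (by linarith), max_eq_right h]; ring
    · rw [max_eq_right (by linarith), max_eq_left h]; ring
  rw [h1, integral_sub (hM _) (hMT n), hT.integral_comp_eq (hM n).1,
    ← integral_sub (hM _) (hM n)]
  exact integral_nonneg fun x => sub_nonneg.2 (maxBirkhoffSum_le_succ n x)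

theorem ae_bddAbove_maxBirkhoffSum (hT : Ergodic T μ) (hf : Integrable f μ)
    (hfm : Measurable f) (hneg : ∫ x, f x ∂μ < 0) :
    ∀ᵐ x ∂μ, BddAbove (Set.range fun n => maxBirkhoffSum T f n x) := by
  have hmeas : MeasurableSet {x | BddAbove (Set.range fun n => maxBirkhoffSum T f n x)} :=
    measurableSet_bddAbove_range fun n => measurable_maxBirkhoffSum hT.measurable hfm n
  rcases hT.toPreErgodic.ae_mem_or_ae_notMem hmeas
    (Set.ext fun x => bddAbove_maxBirkhoffSum_comp x) with h | h
  · exact h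
  · exact absurd hneg (not_lt.2
      (integral_nonneg_of_ae_not_bddAbove_maxBirkhoffSum hT.toMeasurePreserving hf h))

variable [IsProbabilityMeasure μ]

theorem ae_eventually_birkhoffSum_div_lt (hT : Ergodic T μ) (hf : Integrable f μ)
    (hfm : Measurable f) {c : ℝ} (hc : ∫ x, f x ∂μ < c) :
    ∀ᵐ x ∂μ, ∀ᶠ n : ℕ in atTop, birkhoffSum T f n x / n < c := by
  -- Sums of `f - d` stay below a constant `C`; the gap between `d` and `c` absorbs `C / n`.
  obtain ⟨d, hd, hdc⟩ := exists_between hc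
  have hneg : ∫ x, (f x - d) ∂μ < 0 := by
    rw [integral_sub hf (integrable_const _)]
    simpa using hd
  filter_upwards [ae_bddAbove_maxBirkhoffSum hT (hf.sub (integrable_const d))
    (hfm.sub measurable_const) hneg] with x hx
  obtain ⟨C, hC⟩ := hx
  have hlim : Tendsto (fun n : ℕ => C / n + d) atTop (𝓝 (0 + d)) :=
    (tendsto_const_div_atTop_nhds_zero_nat C).add_const d
  rw [zero_add] at hlim
  filter_upwards [hlim.eventually_lt_const hdc, eventually_gt_atTop 0] with n hn hpos
  refine lt_of_le_of_lt ?_ hn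
  obtain ⟨m, rfl⟩ := Nat.exists_eq_succ_of_ne_zero hpos.ne'
  have h1 : birkhoffSum T (fun x => f x - d) (m + 1) x ≤ C :=
    (birkhoffSum_succ_le_maxBirkhoffSum m x).trans (hC ⟨m, rfl⟩)
  have h2 : birkhoffSum T (fun x => f x - d) (m + 1) x
      = birkhoffSum T f (m + 1) x - (m + 1 : ℕ) * d := by
    simp [birkhoffSum, Finset.sum_sub_distrib]
  have hp : (0 : ℝ) < (m + 1 : ℕ) := by positivity
  rw [div_add' _ _ _ hp.ne']
  gcongr
  linarith

/-- **Birkhoff's pointwise ergodic theorem** for an ergodic probability-preserving map. -/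
theorem ae_tendsto_birkhoffSum_div (hT : Ergodic T μ) (hf : Integrable f μ)
    (hfm : Measurable f) :
    ∀ᵐ x ∂μ, Tendsto (fun n : ℕ => birkhoffSum T f n x / n) atTop (𝓝 (∫ x, f x ∂μ)) := by
  have hup : ∀ᵐ x ∂μ, ∀ k : ℕ, ∀ᶠ n : ℕ in atTop,
      birkhoffSum T f n x / n < ∫ x, f x ∂μ + 1 / ((k : ℝ) + 1) :=
    ae_all_iff.2 fun k => ae_eventually_birkhoffSum_div_lt hT hf hfm
      (lt_add_of_pos_right _ Nat.one_div_pos_of_nat)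
  have hlo : ∀ᵐ x ∂μ, ∀ k : ℕ, ∀ᶠ n : ℕ in atTop,
      birkhoffSum T (fun x => -f x) n x / n < ∫ x, -f x ∂μ + 1 / ((k : ℝ) + 1) :=
    ae_all_iff.2 fun k => ae_eventually_birkhoffSum_div_lt hT hf.neg hfm.neg
      (lt_add_of_pos_right _ Nat.one_div_pos_of_nat)
  filter_upwards [hup, hlo] with x h1 h2
  refine Metric.tendsto_nhds.2 fun ε hε => ?_
  obtain ⟨k, hk⟩ := exists_nat_one_div_lt hε
  filter_upwards [h1 k, h2 k] with n a b
  rw [integral_neg] at b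
  have : birkhoffSum T (fun x => -f x) n x = -birkhoffSum T f n x := by
    simp [birkhoffSum]
  rw [this, neg_div] at b
  rw [Real.dist_eq, abs_lt]
  constructor <;> linarith

/-- **Maker's ergodic theorem**: Birkhoff averages of a dominated, almost everywhere convergent
sequence of functions, taken in reversed order along the orbit. -/
theorem ae_tendsto_sum_reversed_div (hT : Ergodic T μ) {g : ℕ → α → ℝ} {gl G : α → ℝ}
    (hg : ∀ j, Measurable (g j)) (hgl : Measurable gl) (hG : Integrable G μ)
    (hbound : ∀ᵐ x ∂μ, ∀ j, |g j x| ≤ G x)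
    (hlim : ∀ᵐ x ∂μ, Tendsto (fun j => g j x) atTop (𝓝 (gl x))) :
    ∀ᵐ x ∂μ, Tendsto (fun n : ℕ => (∑ k ∈ Finset.range n, g (n - 1 - k) (T^[k] x)) / n) atTop
      (𝓝 (∫ x, gl x ∂μ)) := by
  have hgl_le : ∀ᵐ x ∂μ, |gl x| ≤ G x := by
    filter_upwards [hbound, hlim] with x hb hl
    exact le_of_tendsto' hl.abs hb
  have hgli : Integrable gl μ := hG.mono' hgl.aestronglyMeasurable hgl_le
  let D : ℕ → α → ℝ := fun N x => ⨆ j, |g (j + N) x - gl x|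
  have hDm N : Measurable (D N) := Measurable.iSup fun j => ((hg _).sub hgl).abs
  -- A real `⨆` is informative only over a bounded family. This bound supplies that, and is carried
  -- along whole orbits in `horbit`.
  have hle : ∀ᵐ x ∂μ, ∀ j, |g j x - gl x| ≤ 2 * G x := by
    filter_upwards [hbound, hgl_le] with x hb hl j
    have := abs_sub (g j x) (gl x)
    have := hb j
    linarith
  have hD0 N x : 0 ≤ D N x := Real.iSup_nonneg fun j => abs_nonneg _
  have hDle : ∀ᵐ x ∂μ, ∀ N, D N x ≤ 2 * G x := by
    filter_upwards [hle] with x hx N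
    exact ciSup_le fun j => hx _
  have hDi N : Integrable (D N) μ := by
    refine (hG.const_mul 2).mono' (hDm N).aestronglyMeasurable ?_
    filter_upwards [hDle] with x hx
    rw [Real.norm_eq_abs, abs_of_nonneg (hD0 N x)]
    exact hx N
  have hDlim : Tendsto (fun N => ∫ x, D N x ∂μ) atTop (𝓝 (∫ _, (0 : ℝ) ∂μ)) := by
    refine tendsto_integral_of_dominated_convergence (fun x => 2 * G x)
      (fun N => (hDi N).1) (hG.const_mul 2) (fun N => ?_) ?_
    · filter_upwards [hDle] with x hx
      rw [Real.norm_eq_abs, abs_of_nonneg (hD0 N x)]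
      exact hx N
    · filter_upwards [hlim] with x hx
      refine Metric.tendsto_nhds.2 fun ε hε => ?_
      obtain ⟨N, hN⟩ := Metric.tendsto_atTop.1 hx (ε / 2) (by positivity)
      filter_upwards [eventually_ge_atTop N] with n hn
      rw [Real.dist_eq, sub_zero, abs_of_nonneg (hD0 n x)]
      refine lt_of_le_of_lt (ciSup_le fun j => ?_) (half_lt_self hε)
      exact (hN (j + n) (by omega)).le
  rw [integral_zero] at hDlim
  have horbit : ∀ᵐ x ∂μ, ∀ k, ∀ j, |g j (T^[k] x) - gl (T^[k] x)| ≤ 2 * G (T^[k] x) :=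
    ae_all_iff.2 fun k => (hT.toMeasurePreserving.iterate k).quasiMeasurePreserving.ae hle
  filter_upwards [horbit, ae_tendsto_birkhoffSum_div hT hgli hgl,
    ae_all_iff.2 fun N => ae_tendsto_birkhoffSum_div hT (hDi N) (hDm N)] with x hx hglx hDx
  have hterm N j k : |g j (T^[k] x) - gl (T^[k] x)| ≤
      D N (T^[k] x) + if j < N then D 0 (T^[k] x) else 0 := by
    have hbdd M : BddAbove (Set.range fun j => |g (j + M) (T^[k] x) - gl (T^[k] x)|) :=
      ⟨2 * G (T^[k] x), by rintro _ ⟨j, rfl⟩; exact hx k _⟩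
    split_ifs with h
    · have : |g (j + 0) (T^[k] x) - gl (T^[k] x)| ≤ D 0 (T^[k] x) := le_ciSup (hbdd 0) j
      have := hD0 N (T^[k] x)
      simp only [add_zero] at *
      linarith
    · have : |g (j - N + N) (T^[k] x) - gl (T^[k] x)| ≤ D N (T^[k] x) :=
        le_ciSup (hbdd N) (j - N)
      rw [Nat.sub_add_cancel (not_lt.1 h)] at this
      linarith
  -- Only the last `N` times `k` have index `n - 1 - k < N`. Their `D 0` terms form a difference of
  -- two Birkhoff sums, which is `o(n)` by Birkhoff's theorem.
  have hsum N n (hn : N ≤ n) :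
      |(∑ k ∈ Finset.range n, g (n - 1 - k) (T^[k] x)) - birkhoffSum T gl n x| ≤
        birkhoffSum T (D N) n x + (birkhoffSum T (D 0) n x - birkhoffSum T (D 0) (n - N) x) := by
    rw [birkhoffSum, ← Finset.sum_sub_distrib]
    refine (Finset.abs_sum_le_sum_abs _ _).trans
      ((Finset.sum_le_sum fun k _ => hterm N _ k).trans_eq ?_)
    rw [Finset.sum_add_distrib]
    congr 1
    have hsplit := Finset.sum_range_add_sum_Ico (fun k => D 0 (T^[k] x)) (Nat.sub_le n N)
    rw [birkhoffSum, birkhoffSum, ← hsplit, add_sub_cancel_left, ← Finset.sum_filter]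
    refine Finset.sum_congr (Finset.ext fun k => ?_) fun _ _ => rfl
    simp only [Finset.mem_filter, Finset.mem_range, Finset.mem_Ico]
    omega
  have hbl N : Tendsto (fun n : ℕ => birkhoffSum T (D N) n x / n +
      (birkhoffSum T (D 0) n x / n - birkhoffSum T (D 0) (n - N) x / (n - N : ℕ) *
        ((n - N : ℕ) / n))) atTop (𝓝 (∫ x, D N x ∂μ)) := by
    have h1 := (hDx 0).comp (tendsto_sub_atTop_nat N)
    have h2 : Tendsto (fun n : ℕ => ((n - N : ℕ) : ℝ) / n) atTop (𝓝 1) := by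
      have : Tendsto (fun n : ℕ => 1 - (N : ℝ) / n) atTop (𝓝 (1 - 0)) :=
        tendsto_const_nhds.sub (tendsto_const_div_atTop_nhds_zero_nat _)
      rw [sub_zero] at this
      refine this.congr' ?_
      filter_upwards [eventually_ge_atTop N, eventually_gt_atTop 0] with n hn hpos
      have : (n : ℝ) ≠ 0 := by positivity
      rw [Nat.cast_sub hn]
      field_simp
    have := (hDx N).add ((hDx 0).sub (h1.mul h2))
    simpa using this
  have hdiff : Tendsto (fun n : ℕ => (∑ k ∈ Finset.range n, g (n - 1 - k) (T^[k] x)) / n -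
      birkhoffSum T gl n x / n) atTop (𝓝 0) := by
    refine Metric.tendsto_nhds.2 fun ε hε => ?_
    obtain ⟨N, hN⟩ := (hDlim.eventually_lt_const hε).exists
    filter_upwards [(hbl N).eventually_lt_const hN, eventually_gt_atTop N] with n hn hnN
    rw [Real.dist_eq, sub_zero]
    refine lt_of_le_of_lt ?_ hn
    have hpos : (0 : ℝ) < n := by exact_mod_cast (Nat.zero_le N).trans_lt hnN
    have hpos' : (0 : ℝ) < (n - N : ℕ) := by exact_mod_cast Nat.sub_pos_of_lt hnN
    rw [← sub_div, abs_div, abs_of_pos hpos, div_mul_div_cancel₀ hpos'.ne', ← sub_div, ← add_div]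
    gcongr
    exact hsum N n hnN.le
  simpa using hdiff.add hglx

end Birkhoff

/-! ### The Shannon–McMillan–Breiman theorem -/

section ShannonMcMillanBreiman

/-- The probability of the level set of `V` through `ω`. -/
noncomputable def atomProb {α S : Type*} [MeasurableSpace α] (μ : Measure α) (V : α → S) (x : α) :
    ℝ :=
  μ.real (V ⁻¹' {V x})

/-- The first `n` symbols of the `ξ`-name of a point under `T`. -/
def itinerary {α A : Type*} (T : α → α) (ξ : α → A) (n : ℕ) (x : α) : Fin n → A :=
  fun i => ξ (T^[i] x)

/-- The information gained from the zeroth symbol, given the `j` symbols after it. -/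
noncomputable def infoIncrement {α A : Type*} [MeasurableSpace α] (μ : Measure α) (T : α → α)
    (ξ : α → A) (j : ℕ) (x : α) : ℝ :=
  Real.log (atomProb μ (itinerary T ξ j) (T x)) -
    Real.log (atomProb μ (itinerary T ξ (j + 1)) x)

theorem itinerary_succ_eq_iff {α A : Type*} {T : α → α} {ξ : α → A} {n : ℕ} {x y : α} :
    itinerary T ξ (n + 1) x = itinerary T ξ (n + 1) y ↔
      ξ x = ξ y ∧ itinerary T ξ n (T x) = itinerary T ξ n (T y) := by
  simp only [funext_iff, Fin.forall_fin_succ, itinerary, Fin.val_zero, Function.iterate_zero_apply,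
    Fin.val_succ, Function.iterate_succ_apply]

variable {α : Type*} [MeasurableSpace α] {μ : Measure α}

theorem measurable_atomProb {S : Type*} [Finite S] [MeasurableSpace S] [MeasurableSingletonClass S]
    {V : α → S} (hV : Measurable V) : Measurable (atomProb μ V) :=
  (measurable_of_finite fun v => μ.real (V ⁻¹' {v})).comp hV

theorem ae_atomProb_pos {S : Type*} [Finite S] [MeasurableSpace S] [MeasurableSingletonClass S]
    [IsFiniteMeasure μ] (V : α → S) :
    ∀ᵐ x ∂μ, 0 < atomProb μ V x := by
  have h : ∀ᵐ x ∂μ, ∀ v : S, μ (V ⁻¹' {v}) = 0 → V x ≠ v := by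
    refine ae_all_iff.2 fun v => ?_
    by_cases hv : μ (V ⁻¹' {v}) = 0
    · have : ∀ᵐ x ∂μ, x ∉ V ⁻¹' {v} := measure_eq_zero_iff_ae_notMem.1 hv
      filter_upwards [this] with x hx _ h
      exact hx h
    · exact Eventually.of_forall fun x h => absurd h hv
  filter_upwards [h] with x hx
  refine ENNReal.toReal_pos (fun h0 => hx _ h0 rfl) (measure_ne_top _ _)

theorem integrable_comp_of_finite {S : Type*} [Finite S] [MeasurableSpace S]
    [MeasurableSingletonClass S] [IsFiniteMeasure μ] {V : α → S} (hV : Measurable V) (φ : S → ℝ) :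
    Integrable (fun x => φ (V x)) μ := by
  have : Integrable φ (μ.map V) := Integrable.of_finite
  exact this.comp_measurable hV

/-- On `s`, the conditional probabilities of `s` along a filtration are rarely ever small. -/
theorem measure_inter_exists_condProb_le [IsProbabilityMeasure μ] (ℱ : Filtration ℕ ‹_›)
    {s : Set α} (hs : MeasurableSet s) {M : ℕ → α → ℝ} (hM : ∀ j, Measurable[ℱ j] (M j))
    (hMeq : ∀ j, M j =ᵐ[μ] μ⟦s | ℱ j⟧) {r : ℝ} (hr : 0 ≤ r) :
    μ (s ∩ {x | ∃ j, M j x ≤ r}) ≤ ENNReal.ofReal r := by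
  let E : ℕ → Set α := fun j => {x | M j x ≤ r}
  have hE j : MeasurableSet[ℱ j] (E j) := measurableSet_le (hM j) measurable_const
  have hD j : MeasurableSet[ℱ j] (disjointed E j) := by
    rw [disjointed_eq_inter_compl]
    exact (hE j).inter (MeasurableSet.iInter fun i => MeasurableSet.iInter fun hi =>
      (ℱ.mono (le_of_lt hi) _ (hE i)).compl)
  have hDm j : MeasurableSet (disjointed E j) := ℱ.le j _ (hD j)
  have hint : Integrable (s.indicator fun _ => (1 : ℝ)) μ := (integrable_const _).indicator hs
  -- `disjointed E j` says that `j` is the first time with `M j ≤ r`. It lies in `ℱ j`, so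
  -- integrating `M j` over it gives the mass of `s` there.
  have key j : μ (s ∩ disjointed E j) ≤ ENNReal.ofReal r * μ (disjointed E j) := by
    have h1 : ∫ x in disjointed E j, M j x ∂μ = μ.real (s ∩ disjointed E j) := by
      rw [setIntegral_congr_ae (g := μ⟦s | ℱ j⟧) (hDm j)
        ((hMeq j).mono fun x hx _ => hx), setIntegral_condExp (ℱ.le j) hint (hD j),
        integral_indicator_const _ hs, measureReal_restrict_apply hs, smul_eq_mul, mul_one]
    have h2 : ∫ x in disjointed E j, M j x ∂μ ≤ ∫ _ in disjointed E j, r ∂μ := by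
      refine setIntegral_mono_on ?_ (integrable_const _) (hDm j)
        fun x hx => disjointed_subset E j hx
      exact ((integrable_congr (hMeq j)).2 integrable_condExp).integrableOn
    rw [h1, setIntegral_const, smul_eq_mul, mul_comm] at h2
    rw [← ofReal_measureReal, ← ofReal_measureReal (s := disjointed E j), ← ENNReal.ofReal_mul hr]
    exact ENNReal.ofReal_le_ofReal h2
  have hU : {x | ∃ j, M j x ≤ r} = ⋃ j, disjointed E j := by
    rw [iUnion_disjointed]
    ext x
    simp [E]
  rw [hU, Set.inter_iUnion]
  calc μ (⋃ j, s ∩ disjointed E j) ≤ ∑' j, μ (s ∩ disjointed E j) := measure_iUnion_le _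
    _ ≤ ∑' j, ENNReal.ofReal r * μ (disjointed E j) := ENNReal.tsum_le_tsum key
    _ = ENNReal.ofReal r * μ (⋃ j, disjointed E j) := by
      rw [ENNReal.tsum_mul_left, measure_iUnion (disjoint_disjointed E) hDm]
    _ ≤ ENNReal.ofReal r * 1 := by gcongr; exact prob_le_one
    _ = ENNReal.ofReal r := mul_one _

/-- The sum telescopes, ending at the empty name, whose probability is 1. -/
theorem sum_infoIncrement {A : Type*} {T : α → α} {ξ : α → A} [IsProbabilityMeasure μ]
    (n : ℕ) (x : α) :
    ∑ k ∈ Finset.range n, infoIncrement μ T ξ (n - 1 - k) (T^[k] x) =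
      -Real.log (atomProb μ (itinerary T ξ n) x) := by
  have h : ∀ k ∈ Finset.range n, infoIncrement μ T ξ (n - 1 - k) (T^[k] x) =
      Real.log (atomProb μ (itinerary T ξ (n - (k + 1))) (T^[k + 1] x)) -
        Real.log (atomProb μ (itinerary T ξ (n - k)) (T^[k] x)) := fun k hk => by
    have hk := Finset.mem_range.1 hk
    rw [infoIncrement, Function.iterate_succ_apply', show n - 1 - k = n - (k + 1) by omega,
      show n - (k + 1) + 1 = n - k by omega]
  rw [Finset.sum_congr rfl h, Finset.sum_range_sub
    (fun k => Real.log (atomProb μ (itinerary T ξ (n - k)) (T^[k] x)))]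
  have h0 : atomProb μ (itinerary T ξ 0) (T^[n] x) = 1 := by
    rw [atomProb, show itinerary T ξ 0 ⁻¹' {itinerary T ξ 0 (T^[n] x)} = Set.univ from
      Set.eq_univ_of_forall fun y => Subsingleton.elim _ _, probReal_univ]
  rw [Nat.sub_self, h0]
  simp

variable {A : Type*} [MeasurableSpace A] {T : α → α} {ξ : α → A}

theorem measurable_itinerary (hT : Measurable T) (hξ : Measurable ξ) (n : ℕ) :
    Measurable (itinerary T ξ n) :=
  measurable_pi_iff.2 fun i => hξ.comp (hT.iterate i)

/-- The filtration generated by the symbols of the `ξ`-name after the zeroth one. -/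
def tailFiltration (hT : Measurable T) (hξ : Measurable ξ) :
    Filtration ℕ (inferInstance : MeasurableSpace α) where
  seq j := MeasurableSpace.comap (fun x => itinerary T ξ j (T x)) inferInstance
  mono' i j hij := by
    have hres : Measurable fun (v : Fin j → A) (k : Fin i) => v (Fin.castLE hij k) :=
      measurable_pi_iff.2 fun k => measurable_pi_apply _
    have : (fun x => itinerary T ξ i (T x)) =
        (fun (v : Fin j → A) (k : Fin i) => v (Fin.castLE hij k)) ∘
          fun x => itinerary T ξ j (T x) := rfl
    simp only
    rw [this, ← MeasurableSpace.comap_comp]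
    exact MeasurableSpace.comap_mono hres.comap_le
  le' j := ((measurable_itinerary hT hξ j).comp hT).comap_le

theorem measurable_infoIncrement [Finite A] [MeasurableSingletonClass A] (hT : Measurable T) (hξ : Measurable ξ)
    (j : ℕ) :
    Measurable (infoIncrement μ T ξ j) :=
  (Real.measurable_log.comp ((measurable_atomProb (measurable_itinerary hT hξ j)).comp hT)).sub
    (Real.measurable_log.comp (measurable_atomProb (measurable_itinerary hT hξ (j + 1))))

section Finite

variable [Fintype A] [MeasurableSingletonClass A] [Nonempty A] [IsProbabilityMeasure μ]

/-- The conditional probability that the zeroth symbol is `a`, given the next `j` symbols. -/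
noncomputable def tailCondProb (μ : Measure α) [IsFiniteMeasure μ] (T : α → α) (ξ : α → A) (a : A)
    (j : ℕ) (x : α) : ℝ :=
  (condDistrib ξ (fun x => itinerary T ξ j (T x)) μ (itinerary T ξ j (T x))).real {a}

/-- On atoms of positive mass the conditional law is a ratio of atom probabilities; invariance of
`μ` removes the shift from the denominator. -/
theorem ae_infoIncrement_eq (hT : MeasurePreserving T μ μ) (hξ : Measurable ξ) (j : ℕ) :
    ∀ᵐ x ∂μ, 0 < tailCondProb μ T ξ (ξ x) j x ∧
      infoIncrement μ T ξ j x = -Real.log (tailCondProb μ T ξ (ξ x) j x) := by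
  filter_upwards [hT.quasiMeasurePreserving.ae (ae_atomProb_pos (μ := μ) (itinerary T ξ j)),
    ae_atomProb_pos (μ := μ) (itinerary T ξ (j + 1))] with x h1 h2
  have hV : Measurable fun x => itinerary T ξ j (T x) :=
    (measurable_itinerary hT.measurable hξ j).comp hT.measurable
  have hden : μ.map (fun x => itinerary T ξ j (T x)) {itinerary T ξ j (T x)} =
      μ (itinerary T ξ j ⁻¹' {itinerary T ξ j (T x)}) := by
    rw [Measure.map_apply hV (measurableSet_singleton _)]
    exact hT.measure_preimage
      (measurable_itinerary hT.measurable hξ j (measurableSet_singleton _)).nullMeasurableSet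
  have hne : μ (itinerary T ξ j ⁻¹' {itinerary T ξ j (T x)}) ≠ 0 := fun h => by
    simp [atomProb, measureReal_def, h] at h1
  have hnum : (fun a => (itinerary T ξ j (T a), ξ a)) ⁻¹' ({itinerary T ξ j (T x)} ×ˢ {ξ x}) =
      itinerary T ξ (j + 1) ⁻¹' {itinerary T ξ (j + 1) x} := by
    ext y
    simp only [Set.mem_preimage, Set.mem_prod, Set.mem_singleton_iff, itinerary_succ_eq_iff]
    exact and_comm
  have hcond : tailCondProb μ T ξ (ξ x) j x =
      atomProb μ (itinerary T ξ (j + 1)) x / atomProb μ (itinerary T ξ j) (T x) := by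
    rw [tailCondProb, measureReal_def, condDistrib_apply_of_ne_zero hξ _ (by rwa [hden]), hden,
      Measure.map_apply (hV.prodMk hξ)
        ((measurableSet_singleton _).prod (measurableSet_singleton _)), hnum, ENNReal.toReal_mul,
      ENNReal.toReal_inv, atomProb, atomProb, measureReal_def, measureReal_def, div_eq_inv_mul]
  rw [hcond]
  refine ⟨div_pos h2 h1, ?_⟩
  rw [Real.log_div h2.ne' h1.ne', infoIncrement]
  ring

theorem measurable_tailCondProb (hT : Measurable T) (hξ : Measurable ξ) (a : A) (j : ℕ) :
    Measurable[tailFiltration hT hξ j] (tailCondProb μ T ξ a j) :=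
  (measurable_of_finite fun v =>
    (condDistrib ξ (fun x => itinerary T ξ j (T x)) μ v).real {a}).comp
      (comap_measurable fun x => itinerary T ξ j (T x))

theorem tailCondProb_ae_eq (hT : Measurable T) (hξ : Measurable ξ) (a : A) (j : ℕ) :
    tailCondProb μ T ξ a j =ᵐ[μ] μ⟦ξ ⁻¹' {a} | tailFiltration hT hξ j⟧ :=
  condDistrib_ae_eq_condExp ((measurable_itinerary hT hξ j).comp hT) hξ (measurableSet_singleton a)

theorem tailCondProb_le_one (a : A) (j : ℕ) (x : α) : tailCondProb μ T ξ a j x ≤ 1 :=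
  measureReal_le_one

theorem ae_tendsto_tailCondProb (hT : Measurable T) (hξ : Measurable ξ) :
    ∀ᵐ x ∂μ, ∀ a, ∃ l, Tendsto (fun j => tailCondProb μ T ξ a j x) atTop (𝓝 l) := by
  refine ae_all_iff.2 fun a => ?_
  filter_upwards [tendsto_ae_condExp (μ := μ) (ℱ := tailFiltration hT hξ)
    ((ξ ⁻¹' {a}).indicator fun _ => (1 : ℝ)),
    ae_all_iff.2 fun j => tailCondProb_ae_eq (μ := μ) hT hξ a j] with x hx h
  exact ⟨_, hx.congr fun j => (h j).symm⟩

/-- Where `ξ = a`, a large increment means a small conditional probability of `a`. The maximal bound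
with `r = exp (-t)` applies to each of the finitely many `a`. -/
theorem measure_exists_lt_infoIncrement_le (hT : MeasurePreserving T μ μ) (hξ : Measurable ξ)
    (t : ℝ) :
    μ {x | ∃ j, t < infoIncrement μ T ξ j x} ≤
      Fintype.card A * ENNReal.ofReal (Real.exp (-t)) := by
  calc μ {x | ∃ j, t < infoIncrement μ T ξ j x}
      ≤ μ (⋃ a, ξ ⁻¹' {a} ∩ {x | ∃ j, tailCondProb μ T ξ a j x ≤ Real.exp (-t)}) := by
        refine measure_mono_ae ?_
        filter_upwards [ae_all_iff.2 (ae_infoIncrement_eq hT hξ)] with x hx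
        rintro ⟨j, hj⟩
        refine Set.mem_iUnion.2 ⟨ξ x, rfl, j, ?_⟩
        rw [(hx j).2] at hj
        exact ((Real.log_lt_iff_lt_exp (hx j).1).1 (by linarith)).le
    _ ≤ ∑ a, μ (ξ ⁻¹' {a} ∩ {x | ∃ j, tailCondProb μ T ξ a j x ≤ Real.exp (-t)}) :=
        measure_iUnion_fintype_le _ _
    _ ≤ ∑ _a : A, ENNReal.ofReal (Real.exp (-t)) := Finset.sum_le_sum fun a _ =>
        measure_inter_exists_condProb_le (tailFiltration hT.measurable hξ)
          (hξ (measurableSet_singleton a)) (measurable_tailCondProb hT.measurable hξ a)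
          (tailCondProb_ae_eq hT.measurable hξ a) (Real.exp_pos _).le
    _ = _ := by simp

theorem ae_bddAbove_infoIncrement (hT : MeasurePreserving T μ μ) (hξ : Measurable ξ) :
    ∀ᵐ x ∂μ, BddAbove (Set.range fun j => infoIncrement μ T ξ j x) := by
  have hlim : Tendsto (fun n : ℕ => (Fintype.card A : ENNReal) *
      ENNReal.ofReal (Real.exp (-(n : ℝ)))) atTop (𝓝 (Fintype.card A * ENNReal.ofReal 0)) := by
    refine ENNReal.Tendsto.const_mul (ENNReal.tendsto_ofReal ?_) (Or.inr (by simp))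
    exact Real.tendsto_exp_neg_atTop_nhds_zero.comp tendsto_natCast_atTop_atTop
  rw [ENNReal.ofReal_zero, mul_zero] at hlim
  refine ae_iff.2 (le_antisymm (ge_of_tendsto' hlim fun n => ?_) bot_le)
  refine (measure_mono fun x hx => ?_).trans (measure_exists_lt_infoIncrement_le hT hξ n)
  by_contra h
  simp only [Set.mem_ofPred_eq, not_exists, not_lt] at h
  exact hx ⟨n, by rintro _ ⟨j, rfl⟩; exact h j⟩

theorem ae_infoIncrement_nonneg (hT : MeasurePreserving T μ μ) (hξ : Measurable ξ) :
    ∀ᵐ x ∂μ, ∀ j, 0 ≤ infoIncrement μ T ξ j x := by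
  filter_upwards [ae_all_iff.2 (ae_infoIncrement_eq hT hξ)] with x hx j
  rw [(hx j).2]
  exact neg_nonneg.2 (Real.log_nonpos (hx j).1.le (tailCondProb_le_one _ _ _))

/-- By the layer-cake formula, since the tail bound `card A * exp (-t)` is integrable on `t > 0`. -/
theorem integrable_iSup_infoIncrement (hT : MeasurePreserving T μ μ) (hξ : Measurable ξ) :
    Integrable (fun x => ⨆ j, infoIncrement μ T ξ j x) μ := by
  have hm : Measurable fun x => ⨆ j, infoIncrement μ T ξ j x :=
    Measurable.iSup (measurable_infoIncrement hT.measurable hξ)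
  have hnn : 0 ≤ᵐ[μ] fun x => ⨆ j, infoIncrement μ T ξ j x :=
    (ae_infoIncrement_nonneg hT hξ).mono fun x hx => Real.iSup_nonneg hx
  refine ⟨hm.aestronglyMeasurable, (hasFiniteIntegral_iff_ofReal hnn).2 ?_⟩
  rw [lintegral_eq_lintegral_meas_lt μ hnn hm.aemeasurable]
  calc ∫⁻ t in Set.Ioi (0 : ℝ), μ {x | t < ⨆ j, infoIncrement μ T ξ j x}
      ≤ ∫⁻ t in Set.Ioi (0 : ℝ), Fintype.card A * ENNReal.ofReal (Real.exp (-t)) :=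
        lintegral_mono fun t => (measure_mono fun x hx => exists_lt_of_lt_ciSup hx).trans
          (measure_exists_lt_infoIncrement_le hT hξ t)
    _ = Fintype.card A * ∫⁻ t in Set.Ioi (0 : ℝ), ENNReal.ofReal (Real.exp (-t)) :=
        lintegral_const_mul _ (by fun_prop)
    _ < ⊤ := by
        rw [← ofReal_integral_eq_lintegral_ofReal (integrableOn_exp_neg_Ioi 0)
          (Eventually.of_forall fun t => (Real.exp_pos _).le)]
        exact ENNReal.mul_lt_top (by simp) ENNReal.ofReal_lt_top

theorem ae_exists_tendsto_infoIncrement (hT : MeasurePreserving T μ μ) (hξ : Measurable ξ) :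
    ∀ᵐ x ∂μ, ∃ l, Tendsto (fun j => infoIncrement μ T ξ j x) atTop (𝓝 l) := by
  filter_upwards [ae_tendsto_tailCondProb (μ := μ) hT.measurable hξ,
    ae_all_iff.2 (ae_infoIncrement_eq hT hξ), ae_bddAbove_infoIncrement hT hξ] with x h1 h2 h3
  obtain ⟨l, hl⟩ := h1 (ξ x)
  obtain ⟨B, hB⟩ := h3
  -- An upper bound `B` on the increments keeps the conditional probabilities above `exp (-B)`, so
  -- the logarithm is continuous at their limit.
  have hpos : 0 < l := by
    refine (Real.exp_pos (-B)).trans_le (ge_of_tendsto' hl fun j => ?_)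
    rw [← Real.le_log_iff_exp_le (h2 j).1]
    have : infoIncrement μ T ξ j x ≤ B := hB ⟨j, rfl⟩
    rw [(h2 j).2] at this
    linarith
  exact ⟨-Real.log l, ((hl.log hpos.ne').neg).congr fun j => (h2 j).2.symm⟩

/-- **The Shannon–McMillan–Breiman theorem** for a finite-valued observable `ξ` of an ergodic
probability-preserving map `T`. -/
theorem exists_tendsto_neg_log_atomProb_itinerary (hT : Ergodic T μ) (hξ : Measurable ξ) :
    ∃ h : ℝ,
      Tendsto (fun n : ℕ => (∫ x, -Real.log (atomProb μ (itinerary T ξ n) x) ∂μ) / n) atTop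
        (𝓝 h) ∧
      ∀ᵐ x ∂μ, Tendsto (fun n : ℕ => -Real.log (atomProb μ (itinerary T ξ n) x) / n) atTop
        (𝓝 h) := by
  have hP := hT.toMeasurePreserving
  have hg := measurable_infoIncrement (μ := μ) hT.measurable hξ
  obtain ⟨g, hgm, hlim⟩ := measurable_limit_of_tendsto_metrizable_ae (fun j => (hg j).aemeasurable)
    (ae_exists_tendsto_infoIncrement hP hξ)
  have hG := integrable_iSup_infoIncrement hP hξ
  have hbound : ∀ᵐ x ∂μ, ∀ j, |infoIncrement μ T ξ j x| ≤ ⨆ j, infoIncrement μ T ξ j x := by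
    filter_upwards [ae_infoIncrement_nonneg hP hξ, ae_bddAbove_infoIncrement hP hξ] with x h1 h2 j
    rw [abs_of_nonneg (h1 j)]
    exact le_ciSup h2 j
  have hgi j : Integrable (infoIncrement μ T ξ j) μ :=
    hG.mono' (hg j).aestronglyMeasurable (hbound.mono fun x hx => hx j)
  refine ⟨∫ x, g x ∂μ, ?_, ?_⟩
  · have hconv : Tendsto (fun j => ∫ x, infoIncrement μ T ξ j x ∂μ) atTop (𝓝 (∫ x, g x ∂μ)) :=
      tendsto_integral_of_dominated_convergence _ (fun j => (hgi j).1) hG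
        (fun j => hbound.mono fun x hx => hx j) hlim
    -- Invariance removes the shifts under the integral, so the mean information per symbol is a
    -- Cesàro mean of the mean increments.
    refine hconv.cesaro.congr fun n => ?_
    simp_rw [← sum_infoIncrement]
    have hsum : ∫ x, ∑ k ∈ Finset.range n, infoIncrement μ T ξ (n - 1 - k) (T^[k] x) ∂μ =
        ∑ k ∈ Finset.range n, ∫ x, infoIncrement μ T ξ (n - 1 - k) (T^[k] x) ∂μ :=
      integral_finsetSum _ fun k _ =>
        (hP.iterate k).integrable_comp_of_integrable (hgi (n - 1 - k))
    rw [hsum, div_eq_inv_mul]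
    congr 1
    rw [← Finset.sum_range_reflect]
    exact Finset.sum_congr rfl fun k _ =>
      ((hP.iterate k).integral_comp_eq (hgi (n - 1 - k)).1).symm
  · simpa only [sum_infoIncrement] using ae_tendsto_sum_reversed_div hT hg hgm hG hbound hlim

end Finite

end ShannonMcMillanBreiman

/-! ### Conditional information and the chain rule -/

section ConditionalInformation

variable {Ω S U : Type*} [MeasurableSpace Ω] {μ : Measure Ω}

theorem atomProb_congr {V : Ω → S} {W : Ω → U} {ω : Ω}
    (h : ∀ ω', V ω' = V ω ↔ W ω' = W ω) : atomProb μ V ω = atomProb μ W ω := by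
  rw [atomProb, atomProb]
  congr 1
  exact Set.ext h

theorem atomProb_map {β : Type*} [MeasurableSpace β] [MeasurableSpace S]
    [MeasurableSingletonClass S] {φ : Ω → β} (hφ : Measurable φ) {V : β → S} (hV : Measurable V)
    (ω : Ω) : atomProb (μ.map φ) V (φ ω) = atomProb μ (fun ω => V (φ ω)) ω := by
  rw [atomProb, map_measureReal_apply hφ (hV (measurableSet_singleton _))]
  rfl

theorem seqShift_iterate_apply {Z : Type*} (k : ℕ) (z : ℕ → Z) (i : ℕ) :
    seqShift^[k] z i = z (i + k) := by
  induction k generalizing z with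
  | zero => rfl
  | succ k ih =>
    rw [Function.iterate_succ_apply, ih, seqShift]
    congr 1

theorem measurable_block {Z : Type*} [MeasurableSpace Z] {W : ℕ → Ω → Z}
    (hW : ∀ i, Measurable (W i)) (n : ℕ) : Measurable (block W n) :=
  measurable_pi_iff.2 fun i => hW i

/-- The Shannon–McMillan–Breiman theorem for a symbolwise function of an ergodic process. -/
theorem exists_tendsto_neg_log_atomProb_block {Z A : Type*} [MeasurableSpace Z]
    [Fintype A] [MeasurableSpace A] [MeasurableSingletonClass A] [IsProbabilityMeasure μ]
    {W : ℕ → Ω → Z} (hW : ∀ i, Measurable (W i))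
    (hE : Ergodic seqShift (μ.map fun ω i => W i ω)) {φ : Z → A} (hφ : Measurable φ) :
    ∃ h : ℝ,
      Tendsto (fun n : ℕ =>
        (∫ ω, -Real.log (atomProb μ (block (fun i ω => φ (W i ω)) n) ω) ∂μ) / n) atTop (𝓝 h) ∧
      ∀ᵐ ω ∂μ, Tendsto (fun n : ℕ =>
        -Real.log (atomProb μ (block (fun i ω => φ (W i ω)) n) ω) / n) atTop (𝓝 h) := by
  have hpath : Measurable fun ω i => W i ω := measurable_pi_iff.2 hW
  have : IsProbabilityMeasure (μ.map fun ω i => W i ω) :=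
    Measure.isProbabilityMeasure_map hpath.aemeasurable
  -- The observable lives on the full sequence space, so ergodicity of the factor process need not
  -- be proved separately.
  have hξ : Measurable fun z : ℕ → Z => φ (z 0) := hφ.comp (measurable_pi_apply 0)
  have : Nonempty A := (nonempty_of_isProbabilityMeasure μ).map fun ω => φ (W 0 ω)
  have hit n := measurable_itinerary hE.measurable hξ n
  have hblock n : (fun ω => itinerary seqShift (fun z : ℕ → Z => φ (z 0)) n fun i => W i ω) =
      block (fun i ω => φ (W i ω)) n := by
    ext ω i
    simp [itinerary, block, seqShift_iterate_apply]
  have hatom n ω : atomProb (μ.map fun ω i => W i ω)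
      (itinerary seqShift (fun z : ℕ → Z => φ (z 0)) n) (fun i => W i ω) =
      atomProb μ (block (fun i ω => φ (W i ω)) n) ω := by
    rw [← hblock]
    exact atomProb_map hpath (hit n) ω
  obtain ⟨h, h1, h2⟩ := exists_tendsto_neg_log_atomProb_itinerary hE hξ
  refine ⟨h, h1.congr fun n => ?_, ?_⟩
  · have hm : Measurable fun z => -Real.log (atomProb (μ.map fun ω i => W i ω)
        (itinerary seqShift (fun z : ℕ → Z => φ (z 0)) n) z) :=
      (Real.measurable_log.comp (measurable_atomProb (hit n))).neg
    rw [integral_map hpath.aemeasurable hm.aestronglyMeasurable]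
    simp only [hatom]
  · filter_upwards [ae_of_ae_map hpath.aemeasurable h2] with ω hω
    simpa only [hatom] using hω

theorem condPmf_nonneg {V : Ω → S} {W : Ω → U} (v : S) (w : U) : 0 ≤ condPmf μ V W v w := measureReal_nonneg

/-- Equality can fail: conditioning on a null event gives the zero measure. -/
theorem sum_condPmf_le_one [Fintype S] [MeasurableSpace S] [MeasurableSingletonClass S]
    {V : Ω → S} {W : Ω → U} (hV : Measurable V) (w : U) : ∑ v, condPmf μ V W v w ≤ 1 := by
  unfold condPmf
  rw [sum_measureReal_preimage_singleton _ fun v _ => hV (measurableSet_singleton v)]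
  exact measureReal_le_one

theorem measureReal_mul_condPmf [MeasurableSpace U] [MeasurableSingletonClass U]
    [IsProbabilityMeasure μ] {V : Ω → S} {W : Ω → U} (hW : Measurable W) (v : S) (w : U) :
    μ.real (W ⁻¹' {w}) * condPmf μ V W v w = μ.real ((fun ω => (V ω, W ω)) ⁻¹' {(v, w)}) := by
  have hset : (fun ω => (V ω, W ω)) ⁻¹' {(v, w)} = W ⁻¹' {w} ∩ V ⁻¹' {v} := by
    ext ω
    simp [and_comm]
  rw [condPmf, hset, measureReal_def (μ[|_]),
    cond_apply (hW (measurableSet_singleton w)), ENNReal.toReal_mul, ENNReal.toReal_inv,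
    ← measureReal_def, ← measureReal_def]
  by_cases h : μ.real (W ⁻¹' {w}) = 0
  · rw [h, zero_mul]
    exact (le_antisymm ((measureReal_mono Set.inter_subset_left).trans_eq h)
      measureReal_nonneg).symm
  · rw [mul_inv_cancel_left₀ h]

theorem condPmf_eq_div [MeasurableSpace U] [MeasurableSingletonClass U] [IsProbabilityMeasure μ]
    {V : Ω → S} {W : Ω → U} (hW : Measurable W) {ω : Ω} (hω : 0 < atomProb μ W ω) :
    condPmf μ V W (V ω) (W ω) = atomProb μ (fun ω => (V ω, W ω)) ω / atomProb μ W ω := by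
  rw [eq_div_iff hω.ne', mul_comm]
  exact measureReal_mul_condPmf hW _ _

variable [Fintype S] [MeasurableSpace S] [MeasurableSingletonClass S]
  [Fintype U] [MeasurableSpace U] [MeasurableSingletonClass U] [IsProbabilityMeasure μ]
  {V : Ω → S} {W : Ω → U}

theorem ae_condPmf_pos (hW : Measurable W) : ∀ᵐ ω ∂μ, 0 < condPmf μ V W (V ω) (W ω) := by
  filter_upwards [ae_atomProb_pos (μ := μ) W, ae_atomProb_pos (μ := μ) fun ω => (V ω, W ω)]
    with ω h1 h2
  rw [condPmf_eq_div hW h1]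
  exact div_pos h2 h1

theorem ae_neg_logb_condPmf_eq (hW : Measurable W) :
    ∀ᵐ ω ∂μ, -Real.logb 2 (condPmf μ V W (V ω) (W ω)) =
      (-Real.log (atomProb μ (fun ω => (V ω, W ω)) ω) - -Real.log (atomProb μ W ω)) /
        Real.log 2 := by
  filter_upwards [ae_atomProb_pos (μ := μ) W, ae_atomProb_pos (μ := μ) fun ω => (V ω, W ω)]
    with ω h1 h2
  rw [condPmf_eq_div hW h1, Real.logb, Real.log_div h2.ne' h1.ne']
  ring

theorem condEntropy_eq_integral (hV : Measurable V) (hW : Measurable W) :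
    condEntropy μ V W = ∫ ω, -Real.logb 2 (condPmf μ V W (V ω) (W ω)) ∂μ := by
  have hU : Measurable fun ω => (V ω, W ω) := hV.prodMk hW
  have h := integral_map (μ := μ) hU.aemeasurable
    (f := fun p : S × U => -Real.logb 2 (condPmf μ V W p.1 p.2))
    (measurable_of_finite _).aestronglyMeasurable
  rw [← h, integral_fintype Integrable.of_finite, Fintype.sum_prod_type_right, condEntropy]
  refine Finset.sum_congr rfl fun w _ => ?_
  rw [Finset.mul_sum]
  refine Finset.sum_congr rfl fun v _ => ?_
  rw [map_measureReal_apply hU (measurableSet_singleton _), ← measureReal_mul_condPmf hW,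
    smul_eq_mul]
  ring

/-- The chain rule `H(V | W) = H(V, W) - H(W)`. -/
theorem condEntropy_eq_sub (hV : Measurable V) (hW : Measurable W) :
    condEntropy μ V W = (∫ ω, -Real.log (atomProb μ (fun ω => (V ω, W ω)) ω) ∂μ -
      ∫ ω, -Real.log (atomProb μ W ω) ∂μ) / Real.log 2 := by
  rw [condEntropy_eq_integral hV hW, integral_congr_ae (ae_neg_logb_condPmf_eq hW),
    integral_div, integral_sub]
  · exact integrable_comp_of_finite (hV.prodMk hW) fun p =>
      -Real.log (μ.real ((fun ω => (V ω, W ω)) ⁻¹' {p}))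
  · exact integrable_comp_of_finite hW fun w => -Real.log (μ.real (W ⁻¹' {w}))

end ConditionalInformation

/-- The conditional information `-log₂ ℙ(X_1^n | Y_1^n)` grows at the conditional entropy rate. -/
theorem ae_tendsto_neg_logb_condPmf_div {Ω 𝒳 𝒴 : Type*} [MeasurableSpace Ω]
    [Fintype 𝒳] [MeasurableSpace 𝒳] [MeasurableSingletonClass 𝒳]
    [Fintype 𝒴] [MeasurableSpace 𝒴] [MeasurableSingletonClass 𝒴]
    {μ : Measure Ω} [IsProbabilityMeasure μ] {X : ℕ → Ω → 𝒳} {Y : ℕ → Ω → 𝒴}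
    (hXY : IsStationaryErgodicPair μ X Y) :
    ∀ᵐ ω ∂μ, Tendsto (fun n : ℕ => -Real.logb 2
      (condPmf μ (block X n) (block Y n) (block X n ω) (block Y n ω)) / n) atTop
      (𝓝 (condEntropyRate μ X Y)) := by
  have hX n := measurable_block hXY.measurable_source n
  have hY n := measurable_block hXY.measurable_side n
  have hZ : ∀ i, Measurable fun ω => (X i ω, Y i ω) := fun i =>
    (hXY.measurable_source i).prodMk (hXY.measurable_side i)
  obtain ⟨a, ha, ha'⟩ := exists_tendsto_neg_log_atomProb_block hZ hXY.ergodic measurable_id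
  obtain ⟨b, hb, hb'⟩ := exists_tendsto_neg_log_atomProb_block hZ hXY.ergodic measurable_snd
  have hatom n ω : atomProb μ (block (fun i ω => id (X i ω, Y i ω)) n) ω =
      atomProb μ (fun ω => (block X n ω, block Y n ω)) ω := by
    refine atomProb_congr fun ω' => ?_
    simp [block, funext_iff, Prod.ext_iff, forall_and]
  simp only [hatom] at ha ha'
  -- By the chain rule the `limsup` defining the rate is a limit, with the same value as the
  -- pathwise one.
  have hrate : condEntropyRate μ X Y = (a - b) / Real.log 2 := by
    refine Tendsto.limsup_eq (((ha.sub hb).div_const _).congr fun n => ?_)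
    rw [condEntropy_eq_sub (hX n) (hY n), ← sub_div, div_right_comm]
  rw [hrate]
  filter_upwards [ha', hb', ae_all_iff.2 fun n => ae_neg_logb_condPmf_eq (μ := μ) (V := block X n)
    (hY n)] with ω h1 h2 h3
  refine ((h1.sub h2).div_const _).congr fun n => ?_
  rw [h3, ← sub_div, div_right_comm]

/-! ### Length bounds for one-to-one codes -/

section Codes

/-- The strict inequality leaves room for the empty string in the induction. -/
theorem exists_finset_list_length_le (m : ℕ) :
    ∃ F : Finset (List Bool), F.card < 2 ^ (m + 1) ∧ ∀ l, l.length ≤ m → l ∈ F := by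
  induction m with
  | zero => exact ⟨{[]}, by simp, fun l hl => by simpa using hl⟩
  | succ m ih =>
    obtain ⟨F, hF, hmem⟩ := ih
    refine ⟨insert [] (F.image (List.cons true) ∪ F.image (List.cons false)), ?_, ?_⟩
    · have h1 := Finset.card_insert_le []
        (F.image (List.cons true) ∪ F.image (List.cons false))
      have h2 := Finset.card_union_le (F.image (List.cons true)) (F.image (List.cons false))
      have h3 := Finset.card_image_le (s := F) (f := List.cons true)
      have h4 := Finset.card_image_le (s := F) (f := List.cons false)
      rw [pow_succ]
      omega
    · rintro (_ | ⟨b, l⟩) hl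
      · simp
      · have := hmem l (by simpa using hl)
        cases b <;> simp [this]

/-- An injective code has at most `2 ^ (r + 1)` codewords of length at most `r`. -/
theorem card_filter_length_le {S : Type*} [Fintype S] {e : S → List Bool}
    (he : Function.Injective e) (r : ℝ) :
    ((Finset.univ.filter fun x => ((e x).length : ℝ) ≤ r).card : ℝ) ≤ 2 * 2 ^ r := by
  -- Negative `r` does occur, as `r = n * d` for any `d` below the rate; no codeword is then short
  -- enough.
  rcases lt_or_ge r 0 with hr | hr
  · rw [Finset.filter_false_of_mem fun x _ => not_le.2 (hr.trans_le (Nat.cast_nonneg _))]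
    simp only [Finset.card_empty, Nat.cast_zero]
    positivity
  · obtain ⟨F, hF, hmem⟩ := exists_finset_list_length_le ⌊r⌋₊
    have h1 : (Finset.univ.filter fun x => ((e x).length : ℝ) ≤ r).card ≤ F.card :=
      Finset.card_le_card_of_injOn e
        (fun x hx => hmem _ (Nat.le_floor (Finset.mem_filter.1 hx).2)) he.injOn
    calc ((Finset.univ.filter fun x => ((e x).length : ℝ) ≤ r).card : ℝ)
        ≤ (2 ^ (⌊r⌋₊ + 1) : ℕ) := by exact_mod_cast h1.trans hF.le
      _ = 2 * 2 ^ (⌊r⌋₊ : ℝ) := by rw [Real.rpow_natCast]; push_cast; ring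
      _ ≤ 2 * 2 ^ r := by
        gcongr
        · norm_num
        · exact Nat.floor_le hr

theorem two_pow_length_binString_le (k : ℕ) : 2 ^ (binString k).length ≤ k + 1 := by
  rw [← Nat.lt_size, binString, List.length_tail, List.length_reverse, Nat.size_eq_bits_len]
  exact Nat.sub_lt (Nat.size_pos.2 k.succ_pos) one_pos

/-- Coding by rank costs at most the conditional information. -/
theorem length_binString_rank_le {Ω S U : Type*} [MeasurableSpace Ω] {μ : Measure Ω}
    [Fintype S] [MeasurableSpace S] [MeasurableSingletonClass S] {V : Ω → S} {W : Ω → U}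
    (hV : Measurable V) {w : U}
    (rank : S ≃ Fin (Fintype.card S))
    (hrank : ∀ v v', rank v ≤ rank v' → condPmf μ V W v' w ≤ condPmf μ V W v w) {v : S}
    (hv : 0 < condPmf μ V W v w) :
    ((binString (rank v)).length : ℝ) ≤ -Real.logb 2 (condPmf μ V W v w) := by
  -- The `rank v + 1` values ranked up to `v` are each at least as probable as `v`.
  have h1 : ((rank v : ℕ) + 1 : ℝ) * condPmf μ V W v w ≤ 1 := by
    calc ((rank v : ℕ) + 1 : ℝ) * condPmf μ V W v w
        = ∑ _i ∈ Finset.Iic (rank v), condPmf μ V W v w := by simp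
      _ ≤ ∑ i ∈ Finset.Iic (rank v), condPmf μ V W (rank.symm i) w :=
          Finset.sum_le_sum fun i hi => hrank _ _ (by simpa using hi)
      _ ≤ ∑ i, condPmf μ V W (rank.symm i) w :=
          Finset.sum_le_univ_sum_of_nonneg fun i => condPmf_nonneg _ _
      _ = ∑ v, condPmf μ V W v w := Equiv.sum_comp rank.symm fun v => condPmf μ V W v w
      _ ≤ 1 := sum_condPmf_le_one hV w
  have h2 : (2 : ℝ) ^ (binString (rank v)).length ≤ (rank v : ℕ) + 1 := by
    exact_mod_cast two_pow_length_binString_le (rank v)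
  rw [← Real.logb_inv, Real.le_logb_iff_rpow_le one_lt_two (inv_pos.2 hv), Real.rpow_natCast,
    ← one_div, le_div_iff₀ hv]
  exact (mul_le_mul_of_nonneg_right h2 hv.le).trans h1

variable {Ω S U : Type*} [MeasurableSpace Ω] {μ : Measure Ω} [IsProbabilityMeasure μ]
  [Fintype S] [MeasurableSpace S] [MeasurableSingletonClass S]
  [Fintype U] [MeasurableSpace U] [MeasurableSingletonClass U]
  {V : Ω → S} {W : Ω → U}

/-- A one-to-one code rarely assigns short codewords to conditionally improbable values. -/
theorem measureReal_length_le_and_condPmf_le (hV : Measurable V) (hW : Measurable W)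
    {e : S → U → List Bool} (he : ∀ w, Function.Injective fun v => e v w) (r : ℝ) {q : ℝ}
    (hq : 0 ≤ q) :
    μ.real {ω | ((e (V ω) (W ω)).length : ℝ) ≤ r ∧ condPmf μ V W (V ω) (W ω) ≤ q} ≤
      2 * 2 ^ r * q := by
  classical
  let F : Finset (S × U) := Finset.univ.filter fun p =>
    ((e p.1 p.2).length : ℝ) ≤ r ∧ condPmf μ V W p.1 p.2 ≤ q
  have hset : {ω | ((e (V ω) (W ω)).length : ℝ) ≤ r ∧ condPmf μ V W (V ω) (W ω) ≤ q} =
      (fun ω => (V ω, W ω)) ⁻¹' F := by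
    ext ω
    simp [F]
  have hone : ∑ w, μ.real (W ⁻¹' {w}) = 1 := by
    rw [sum_measureReal_preimage_singleton _ fun w _ => hW (measurableSet_singleton w)]
    simp
  rw [hset, ← sum_measureReal_preimage_singleton F fun p _ =>
    (hV.prodMk hW) (measurableSet_singleton p), Finset.sum_filter, Fintype.sum_prod_type_right]
  calc ∑ w, ∑ v, (if ((e v w).length : ℝ) ≤ r ∧ condPmf μ V W v w ≤ q then
        μ.real ((fun ω => (V ω, W ω)) ⁻¹' {(v, w)}) else 0)
      ≤ ∑ w, μ.real (W ⁻¹' {w}) * (2 * 2 ^ r * q) := by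
        refine Finset.sum_le_sum fun w _ => ?_
        calc _ ≤ ∑ v, if ((e v w).length : ℝ) ≤ r then μ.real (W ⁻¹' {w}) * q else 0 := by
              refine Finset.sum_le_sum fun v _ => ?_
              by_cases h1 : ((e v w).length : ℝ) ≤ r
              · by_cases h2 : condPmf μ V W v w ≤ q
                · rw [if_pos ⟨h1, h2⟩, if_pos h1, ← measureReal_mul_condPmf hW]
                  gcongr
                · rw [if_neg fun h => h2 h.2, if_pos h1]
                  positivity
              · rw [if_neg fun h => h1 h.1, if_neg h1]
          _ = (Finset.univ.filter fun v => ((e v w).length : ℝ) ≤ r).card *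
                (μ.real (W ⁻¹' {w}) * q) := by
              rw [← Finset.sum_filter, Finset.sum_const, nsmul_eq_mul]
          _ ≤ 2 * 2 ^ r * (μ.real (W ⁻¹' {w}) * q) := by
              gcongr
              exact card_filter_length_le (he w) r
          _ = _ := by ring
    _ = 2 * 2 ^ r * q := by rw [← Finset.sum_mul, hone, one_mul]

end Codes

/-! ### Almost sure rates of compressors -/

section Rates

variable {Ω 𝒳 𝒴 : Type*} [MeasurableSpace Ω]
  [Fintype 𝒳] [MeasurableSpace 𝒳] [MeasurableSingletonClass 𝒳]
  [Fintype 𝒴] [MeasurableSpace 𝒴] [MeasurableSingletonClass 𝒴]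
  {μ : Measure Ω} [IsProbabilityMeasure μ] {X : ℕ → Ω → 𝒳} {Y : ℕ → Ω → 𝒴}

theorem ae_eventually_lt_length_div (hXY : IsStationaryErgodicPair μ X Y)
    (f : (n : ℕ) → SideInfoCompressor 𝒳 𝒴 n) {d : ℝ} (hd : d < condEntropyRate μ X Y) :
    ∀ᵐ ω ∂μ, ∀ᶠ n : ℕ in atTop,
      d < (((f n).encode (block X n ω) (block Y n ω)).length : ℝ) / n := by
  -- The gap between `d` and `c` makes the probability of `E n` at most `2 * 2 ^ (-n (c - d))`,
  -- which is summable. Eventually the conditional probability is below `2 ^ (-n c)`, so only `E n`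
  -- could permit a short codeword.
  obtain ⟨c, hdc, hc⟩ := exists_between hd
  let E : ℕ → Set Ω := fun n =>
    {ω | (((f n).encode (block X n ω) (block Y n ω)).length : ℝ) ≤ n * d ∧
      condPmf μ (block X n) (block Y n) (block X n ω) (block Y n ω) ≤ 2 ^ (-(n * c))}
  have hE n : μ (E n) ≤ ENNReal.ofReal (2 * ((2 : ℝ) ^ (d - c)) ^ n) := by
    rw [← ofReal_measureReal]
    refine ENNReal.ofReal_le_ofReal ((measureReal_length_le_and_condPmf_le
      (measurable_block hXY.measurable_source n) (measurable_block hXY.measurable_side n)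
      (f n).injective (n * d) (by positivity)).trans_eq ?_)
    rw [mul_assoc, ← Real.rpow_add two_pos, ← Real.rpow_natCast, ← Real.rpow_mul two_pos.le]
    ring_nf
  have hsum : Summable fun n : ℕ => 2 * ((2 : ℝ) ^ (d - c)) ^ n :=
    (summable_geometric_of_lt_one (by positivity)
      (Real.rpow_lt_one_of_one_lt_of_neg one_lt_two (by linarith))).mul_left 2
  have hfin : ∑' n, μ (E n) ≠ ⊤ :=
    ne_top_of_le_ne_top hsum.tsum_ofReal_ne_top (ENNReal.tsum_le_tsum hE)
  filter_upwards [ae_eventually_notMem hfin, ae_tendsto_neg_logb_condPmf_div hXY,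
    ae_all_iff.2 fun n => ae_condPmf_pos (μ := μ) (V := block X n)
      (measurable_block hXY.measurable_side n)] with ω h1 h2 h3
  filter_upwards [h1, h2.eventually_const_lt hc, eventually_gt_atTop 0] with n h4 h5 hn
  have hpos : (0 : ℝ) < n := by exact_mod_cast hn
  rw [lt_div_iff₀' hpos] at h5 ⊢
  by_contra hle
  refine h4 ⟨not_lt.1 hle, ?_⟩
  rw [← Real.logb_le_iff_le_rpow one_lt_two (h3 n)]
  linarith

/-- Countably many thresholds increasing to the rate give one null set serving all `d`. -/
theorem ae_forall_lt_eventually_lt_length_div (hXY : IsStationaryErgodicPair μ X Y)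
    (f : (n : ℕ) → SideInfoCompressor 𝒳 𝒴 n) :
    ∀ᵐ ω ∂μ, ∀ d < condEntropyRate μ X Y, ∀ᶠ n : ℕ in atTop,
      d < (((f n).encode (block X n ω) (block Y n ω)).length : ℝ) / n := by
  have h : ∀ᵐ ω ∂μ, ∀ k : ℕ, ∀ᶠ n : ℕ in atTop,
      condEntropyRate μ X Y - 1 / ((k : ℝ) + 1) <
        (((f n).encode (block X n ω) (block Y n ω)).length : ℝ) / n :=
    ae_all_iff.2 fun k => ae_eventually_lt_length_div hXY f
      (sub_lt_self _ Nat.one_div_pos_of_nat)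
  filter_upwards [h] with ω hω d hd
  obtain ⟨k, hk⟩ := exists_nat_one_div_lt (sub_pos.2 hd)
  exact (hω k).mono fun n hn => lt_trans (by linarith) hn

theorem ae_tendsto_length_div_of_isOptimalCompressor (hXY : IsStationaryErgodicPair μ X Y)
    (f : (n : ℕ) → SideInfoCompressor 𝒳 𝒴 n) (hf : ∀ n, IsOptimalCompressor μ X Y n (f n)) :
    ∀ᵐ ω ∂μ, Tendsto (fun n : ℕ =>
      (((f n).encode (block X n ω) (block Y n ω)).length : ℝ) / n) atTop
        (𝓝 (condEntropyRate μ X Y)) := by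
  filter_upwards [ae_forall_lt_eventually_lt_length_div hXY f, ae_tendsto_neg_logb_condPmf_div hXY,
    ae_all_iff.2 fun n => ae_condPmf_pos (μ := μ) (V := block X n)
      (measurable_block hXY.measurable_side n)] with ω h1 h2 h3
  refine tendsto_order.2 ⟨h1, fun d hd => ?_⟩
  filter_upwards [h2.eventually_lt_const hd] with n hn
  refine lt_of_le_of_lt ?_ hn
  obtain ⟨rank, hrank, henc⟩ := hf n (block Y n ω)
  rw [henc]
  gcongr
  exact length_binString_rank_le (measurable_block hXY.measurable_source n) rank hrank (h3 n)

end Rates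

/-- The `liminf` is taken in `EReal` because arbitrary compressors may have unbounded normalized
lengths, where a real `liminf` can take a default value. -/
theorem theoremt {Ω 𝒳 𝒴 : Type*} [MeasurableSpace Ω]
    [Fintype 𝒳] [MeasurableSpace 𝒳] [MeasurableSingletonClass 𝒳]
    [Fintype 𝒴] [MeasurableSpace 𝒴] [MeasurableSingletonClass 𝒴]
    (μ : Measure Ω) [IsProbabilityMeasure μ] (X : ℕ → Ω → 𝒳) (Y : ℕ → Ω → 𝒴)
    (hXY : IsStationaryErgodicPair μ X Y) :
    (∀ f : (n : ℕ) → SideInfoCompressor 𝒳 𝒴 n, ∀ᵐ ω ∂μ,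
      ((condEntropyRate μ X Y : ℝ) : EReal) ≤
        liminf (fun n : ℕ =>
          ((((((f n).encode (block X n ω) (block Y n ω)).length : ℝ) / n : ℝ)) : EReal)) atTop) ∧
    (∀ f : (n : ℕ) → SideInfoCompressor 𝒳 𝒴 n, (∀ n, IsOptimalCompressor μ X Y n (f n)) →
      ∀ᵐ ω ∂μ,
        liminf (fun n : ℕ =>
          ((((((f n).encode (block X n ω) (block Y n ω)).length : ℝ) / n : ℝ)) : EReal)) atTop =
            ((condEntropyRate μ X Y : ℝ) : EReal) ∧
        Tendsto (fun n : ℕ =>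
          (((f n).encode (block X n ω) (block Y n ω)).length : ℝ) / n) atTop
            (𝓝 (condEntropyRate μ X Y))) := by
  refine ⟨fun f => ?_, fun f hf => ?_⟩
  · filter_upwards [ae_forall_lt_eventually_lt_length_div hXY f] with ω hω
    refine le_of_forall_lt fun c hc => ?_
    obtain ⟨d, hcd, hd⟩ := EReal.lt_iff_exists_real_btwn.1 hc
    refine hcd.trans_le (le_liminf_of_le (h := ?_))
    exact (hω d (EReal.coe_lt_coe_iff.1 hd)).mono fun n hn => EReal.coe_le_coe_iff.2 hn.le
  · filter_upwards [ae_tendsto_length_div_of_isOptimalCompressor hXY f hf] with ω hω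
    exact ⟨((continuous_coe_real_ereal.tendsto _).comp hω).liminf_eq, hω⟩
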